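/- All graphs are finite and simple. For a graph $G$, let $e(G)$ denote its number of edges. Let $K_m$ be the complete graph on $m$ vertices, $mK_1$ the edgeless graph on $m$ vertices, $G_1\cup G_2$ the disjoint union, and $G_1\vee G_2$ the join (the disjoint union together with all edges between $V(G_1)$ and $V(G_2)$). An even factor of $G$ is a spanning subgraph $F$ of $G$ with $d_F(v)\in\{2,4,6,\ldots\}$ for every vertex $v\in V(G)$. Theorem 1.1. Let $G$ be a connected graph of even order $n$ with minimum degree $\delta\ge 2$, and suppose that $n\ge\max\{6\delta-4,\ \tfrac16(\delta^2+7\delta+4)\}$. If $$e(G)\ \ge\ e\bigl(K_\delta\vee(K_{n-2\delta+1}\cup(\delta-1)K_1)\bigr)$$ and $G$ is not isomorphic to $K_\delta\vee(K_{n-2\delta+1}\cup(\delta-1)K_1)$, then $G$ contains an even factor. -/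

import Mathlib

namespace EvenFactor

/-- The join `G ∨ H` of two vertex-disjoint graphs: their disjoint union together with all edges
between the vertices of `G` and the vertices of `H`. -/
def join {V W : Type*} (G : SimpleGraph V) (H : SimpleGraph W) : SimpleGraph (V ⊕ W) :=
  SimpleGraph.sum G H ⊔ completeBipartiteGraph V W

/-- The graph `K_δ ∨ (K_{n-2δ+1} ∪ (δ-1) K_1)`. The natural-number subtractions are exact
for `1 ≤ δ` and `2 * δ ≤ n + 1`. -/
def extremalGraph (n δ : ℕ) : SimpleGraph (Fin δ ⊕ (Fin (n + 1 - 2 * δ) ⊕ Fin (δ - 1))) :=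
  join (⊤ : SimpleGraph (Fin δ))
    (SimpleGraph.sum (⊤ : SimpleGraph (Fin (n + 1 - 2 * δ))) (⊥ : SimpleGraph (Fin (δ - 1))))

/-- The size `e(G)` of a (finite) graph: its number of edges. -/
noncomputable def size {V : Type*} (G : SimpleGraph V) : ℕ := G.edgeSet.ncard

/-- `G` has an even factor: a spanning subgraph `F` all of whose degrees lie in `{2, 4, 6, …}`. -/
def HasEvenFactor {V : Type*} (G : SimpleGraph V) : Prop :=
  ∃ F : G.Subgraph, F.IsSpanning ∧
    ∀ v : V, Even (F.neighborSet v).ncard ∧ 2 ≤ (F.neighborSet v).ncard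

end EvenFactor

/-!
Under the size bound `G` is even Hamiltonian, and a Hamiltonian cycle is a spanning subgraph all of
whose degrees are `2`. This is Erdős's argument.

If `G` is not Hamiltonian, Chvátal's degree condition fails: for some `h` with `δ ≤ h < n / 2` there
are `h` vertices of degree at most `h` (`exists_card_degree_le_of_not_isHamSeq`, by the crossing
argument of Bondy and Chvátal in an edge-maximal non-Hamiltonian graph above `G`). Counting degrees
then gives `2 e(G) ≤ 2 h ^ 2 + (n - h) (n - h - 1)` (`two_mul_card_edgeFinset_le`). This is convex
in `h`, and for `n` even and `n ≥ 6 δ - 4` its value on `δ ≤ h ≤ n / 2 - 1` is largest at `h = δ`,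
where it falls short of twice the size of the extremal graph (`two_mul_size_extremalGraph`) by
`2 (n - 2 δ) > 0`.
-/

namespace EvenFactor

open Finset

/-! ### Hamiltonian cycles as sequences -/

/-- A Hamiltonian cycle of a graph on `N` vertices, encoded as a sequence `x` of which only the
terms `x 0, …, x (N - 1)` matter: they are distinct, and cyclically consecutive ones are
adjacent. -/
structure IsHamSeq {V : Type*} [Fintype V] (G : SimpleGraph V) (x : ℕ → V) : Prop where
  inj : ∀ i j, i < Fintype.card V → j < Fintype.card V → x i = x j → i = j
  adj : ∀ i, i + 1 < Fintype.card V → G.Adj (x i) (x (i + 1))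
  closing : G.Adj (x (Fintype.card V - 1)) (x 0)

variable {V : Type*} [Fintype V]

lemma exists_lt_card_eq {x : ℕ → V}
    (inj : ∀ i j, i < Fintype.card V → j < Fintype.card V → x i = x j → i = j) (v : V) :
    ∃ i < Fintype.card V, x i = v := by
  have hinj : Function.Injective (fun i : Fin (Fintype.card V) => x i) := fun i j hij =>
    Fin.ext (inj i j i.2 j.2 hij)
  have hb := (Fintype.bijective_iff_injective_and_card _).2 ⟨hinj, Fintype.card_fin _⟩
  obtain ⟨i, hi⟩ := hb.2 v
  exact ⟨i, i.2, hi⟩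

/-- The edges of a Hamiltonian cycle form a spanning subgraph that is regular of degree two. -/
lemma IsHamSeq.hasEvenFactor {G : SimpleGraph V} {x : ℕ → V} (hx : IsHamSeq G x)
    (h3 : 3 ≤ Fintype.card V) : HasEvenFactor G := by
  obtain ⟨inj, adj, closing⟩ := hx
  set n := Fintype.card V with hn
  let F : G.Subgraph :=
    { verts := Set.univ
      Adj := fun a b => ∃ i j, i < n ∧ j < n ∧ x i = a ∧ x j = b ∧
        (j = i + 1 ∨ i = j + 1 ∨ (i = 0 ∧ j = n - 1) ∨ (j = 0 ∧ i = n - 1))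
      adj_sub := by
        rintro a b ⟨i, j, hi, hj, rfl, rfl, h | h | ⟨h, h'⟩ | ⟨h, h'⟩⟩
        · subst h; exact adj i hj
        · subst h; exact (adj j hi).symm
        · subst h h'; exact closing.symm
        · subst h h'; exact closing
      edge_vert := fun _ => Set.mem_univ _
      symm := ⟨by
        rintro a b ⟨i, j, hi, hj, h1, h2, h⟩
        exact ⟨j, i, hj, hi, h2, h1, by tauto⟩⟩ }
  refine ⟨F, fun v => Set.mem_univ v, fun v => ?_⟩
  suffices h : (F.neighborSet v).ncard = 2 by rw [h]; exact ⟨even_two, le_rfl⟩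
  obtain ⟨i, hi, rfl⟩ := exists_lt_card_eq inj v
  obtain ⟨p, q, hp, hq, hpq, hnb⟩ : ∃ p q, p < n ∧ q < n ∧ p ≠ q ∧ ∀ j < n,
      (j = i + 1 ∨ i = j + 1 ∨ (i = 0 ∧ j = n - 1) ∨ (j = 0 ∧ i = n - 1)) ↔ j = p ∨ j = q := by
    rcases Nat.eq_zero_or_pos i with h0 | h0
    · exact ⟨1, n - 1, by omega, by omega, by omega, fun j hj => by omega⟩
    · rcases Nat.lt_or_ge (i + 1) n with h1 | h1
      · exact ⟨i - 1, i + 1, by omega, by omega, by omega, fun j hj => by omega⟩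
      · exact ⟨i - 1, 0, by omega, by omega, by omega, fun j hj => by omega⟩
  have hset : F.neighborSet (x i) = {x p, x q} := by
    ext b
    simp only [SimpleGraph.Subgraph.mem_neighborSet, Set.mem_insert_iff, Set.mem_singleton_iff]
    constructor
    · rintro ⟨i', j, hi', hj, h1, rfl, h⟩
      obtain rfl := inj _ _ hi' hi h1
      rcases (hnb j hj).1 h with rfl | rfl <;> simp
    · rintro (rfl | rfl)
      · exact ⟨i, p, hi, hp, rfl, rfl, (hnb p hp).2 (Or.inl rfl)⟩
      · exact ⟨i, q, hi, hq, rfl, rfl, (hnb q hq).2 (Or.inr rfl)⟩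
  rw [hset, Set.ncard_pair]
  exact fun h => hpq (inj _ _ hp hq h)

/-! ### Closing Hamiltonian paths -/

/-- A Hamiltonian path whose ends `x 0` and `x (n - 1)` have degrees summing to at least `n` closes
up to a Hamiltonian cycle: by pigeonhole some `x i` is adjacent to the last vertex while
`x (i + 1)` is adjacent to the first, and reversing the path after `x i` gives the cycle. -/
lemma exists_isHamSeq_of_path {G : SimpleGraph V} [DecidableRel G.Adj] {x : ℕ → V}
    (inj : ∀ i j, i < Fintype.card V → j < Fintype.card V → x i = x j → i = j)
    (adj : ∀ i, i + 1 < Fintype.card V → G.Adj (x i) (x (i + 1)))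
    (hdeg : Fintype.card V ≤ G.degree (x 0) + G.degree (x (Fintype.card V - 1))) :
    ∃ y, IsHamSeq G y := by
  classical
  have hn0 : 0 < Fintype.card V := Fintype.card_pos_iff.2 ⟨x 0⟩
  set n := Fintype.card V with hn
  let A := (range (n - 1)).filter fun i => G.Adj (x 0) (x (i + 1))
  let B := (range (n - 1)).filter fun i => G.Adj (x i) (x (n - 1))
  have hA : G.degree (x 0) ≤ #A := by
    rw [← G.card_neighborFinset_eq_degree]
    refine (card_le_card (t := A.image fun i => x (i + 1)) fun w hw => ?_).trans card_image_le
    rw [SimpleGraph.mem_neighborFinset] at hw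
    obtain ⟨i, hi, rfl⟩ := exists_lt_card_eq inj w
    obtain _ | i := i
    · exact (G.loopless.irrefl _ hw).elim
    · exact mem_image.2 ⟨i, by simp only [A, mem_filter, mem_range]; exact ⟨by omega, hw⟩, rfl⟩
  have hB : G.degree (x (n - 1)) ≤ #B := by
    rw [← G.card_neighborFinset_eq_degree]
    refine (card_le_card (t := B.image x) fun w hw => ?_).trans card_image_le
    rw [SimpleGraph.mem_neighborFinset] at hw
    obtain ⟨i, hi, rfl⟩ := exists_lt_card_eq inj w
    have hne : i ≠ n - 1 := by
      rintro rfl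
      exact G.loopless.irrefl _ hw
    exact mem_image.2 ⟨i, by simp only [B, mem_filter, mem_range]; exact ⟨by omega, hw.symm⟩, rfl⟩
  obtain ⟨i, hi⟩ : (A ∩ B).Nonempty := by
    rw [← card_pos]
    have h1 := card_union_add_card_inter A B
    have h2 : #(A ∪ B) ≤ n - 1 := by
      simpa using card_le_card (union_subset (filter_subset _ _) (filter_subset _ _) :
        A ∪ B ⊆ range (n - 1))
    omega
  simp only [A, B, mem_inter, mem_filter, mem_range] at hi
  obtain ⟨⟨hin, h0⟩, -, h1⟩ := hi
  refine ⟨fun j => if j ≤ i then x j else x (n + i - j), ?_, ?_, ?_⟩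
  · intro j k hj hk hjk
    split_ifs at hjk with hji hki hki
    · exact inj _ _ hj hk hjk
    · have := inj _ _ hj (by omega) hjk; omega
    · have := inj _ _ (by omega) hk hjk; omega
    · have := inj _ _ (by omega) (by omega) hjk; omega
  · intro j hj
    split_ifs with hji hki hki
    · exact adj j hj
    · obtain rfl : j = i := by omega
      rwa [show n + j - (j + 1) = n - 1 by omega]
    · omega
    · have := (adj (n + i - (j + 1)) (by omega)).symm
      rwa [show n + i - (j + 1) + 1 = n + i - j by omega] at this
  · rw [if_neg (by omega), if_pos (Nat.zero_le _), ← hn, show n + i - (n - 1) = i + 1 by omega]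
    exact h0.symm

/-- Rotating a Hamiltonian cycle so that the step from `x k` to its successor is the closing one. -/
lemma IsHamSeq.rotate {G : SimpleGraph V} {x : ℕ → V} (hx : IsHamSeq G x) {k : ℕ}
    (hk : k + 1 < Fintype.card V) :
    ∃ y, IsHamSeq G y ∧ y 0 = x (k + 1) ∧ y (Fintype.card V - 1) = x k := by
  obtain ⟨inj, adj, closing⟩ := hx
  set n := Fintype.card V with hn
  refine ⟨fun j => if j + (k + 1) < n then x (j + (k + 1)) else x (j + (k + 1) - n),
    ⟨?_, ?_, ?_⟩, ?_, ?_⟩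
  · intro i j hi hj hij
    split_ifs at hij with h1 h2 h2
    all_goals have := inj _ _ (by omega) (by omega) hij; omega
  · intro j hj
    split_ifs with h1 h2 h2
    · rw [show j + 1 + (k + 1) = j + (k + 1) + 1 by omega]
      exact adj _ (by omega)
    · rw [show j + 1 + (k + 1) - n = 0 by omega, show j + (k + 1) = n - 1 by omega]
      exact closing
    · omega
    · rw [show j + 1 + (k + 1) - n = j + (k + 1) - n + 1 by omega]
      exact adj _ (by omega)
  · rw [← hn, if_neg (by omega), if_pos (by omega), show n - 1 + (k + 1) - n = k by omega,
      zero_add]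
    exact adj k hk
  · dsimp only
    rw [if_pos (by omega), zero_add]
  · dsimp only
    rw [if_neg (by omega), show n - 1 + (k + 1) - n = k by omega]

/-- The step of the Bondy–Chvátal closure: an edge joining two vertices of degree sum at least `n`
is irrelevant for Hamiltonicity. -/
lemma exists_isHamSeq_of_sup_edge {G : SimpleGraph V} [DecidableRel G.Adj] {u v : V} {x : ℕ → V}
    (h3 : 3 ≤ Fintype.card V) (hx : IsHamSeq (G ⊔ SimpleGraph.edge u v) x)
    (hdeg : Fintype.card V ≤ G.degree u + G.degree v) : ∃ y, IsHamSeq G y := by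
  have key : ∀ y, IsHamSeq (G ⊔ SimpleGraph.edge u v) y →
      (y 0 = u ∧ y (Fintype.card V - 1) = v ∨ y 0 = v ∧ y (Fintype.card V - 1) = u) →
      ∃ y, IsHamSeq G y := by
    intro y hy hends
    refine exists_isHamSeq_of_path hy.inj (fun i hi => ?_) ?_
    · refine (SimpleGraph.sup_adj .. |>.1 (hy.adj i hi)).resolve_right fun he => ?_
      rw [SimpleGraph.edge_adj] at he
      -- otherwise `y i` and `y (i + 1)` would be the first and the last vertex in some order
      have a1 := hy.inj i 0 (by omega) (by omega)
      have a2 := hy.inj i (Fintype.card V - 1) (by omega) (by omega)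
      have a3 := hy.inj (i + 1) 0 (by omega) (by omega)
      have a4 := hy.inj (i + 1) (Fintype.card V - 1) (by omega) (by omega)
      grind
    · rcases hends with ⟨h1, h2⟩ | ⟨h1, h2⟩ <;> rw [h1, h2] <;> omega
  by_cases hall : ∀ i, i + 1 < Fintype.card V → G.Adj (x i) (x (i + 1))
  · rcases SimpleGraph.sup_adj .. |>.1 hx.closing with h | h
    · exact ⟨x, hx.inj, hall, h⟩
    · rw [SimpleGraph.edge_adj] at h
      exact key x hx (by tauto)
  · push Not at hall
    obtain ⟨k, hk, hnk⟩ := hall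
    have h := (SimpleGraph.sup_adj .. |>.1 (hx.adj k hk)).resolve_left hnk
    rw [SimpleGraph.edge_adj] at h
    obtain ⟨y, hy, h0, h1⟩ := hx.rotate hk
    exact key y hy (by rw [h0, h1]; tauto)

/-! ### The degree condition for non-Hamiltonian graphs -/

lemma exists_isHamSeq_top (h3 : 3 ≤ Fintype.card V) :
    ∃ x, IsHamSeq (⊤ : SimpleGraph V) x := by
  let e := (Fintype.equivFin V).symm
  let x : ℕ → V := fun i => e ⟨i % Fintype.card V, Nat.mod_lt _ (by omega)⟩
  have inj : ∀ i j, i < Fintype.card V → j < Fintype.card V → x i = x j → i = j := by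
    intro i j hi hj h
    have := congrArg Fin.val (e.injective h)
    simpa [Nat.mod_eq_of_lt hi, Nat.mod_eq_of_lt hj] using this
  refine ⟨x, inj, fun i hi h => ?_, fun h => ?_⟩
  · have := inj _ _ (by omega) hi h; omega
  · have := inj _ _ (by omega) (by omega) h; omega

/-- A weak form of Chvátal's degree condition: a non-Hamiltonian graph has, for some `h < n / 2` not
smaller than the minimum degree, `h` vertices of degree at most `h`.

In an edge-maximal non-Hamiltonian graph `M` containing `G`, take nonadjacent `u`, `v` of maximum
degree sum, with `h = deg u ≤ deg v`. Then `deg u + deg v < n`, so at least `h` vertices are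
nonadjacent to `v`, and by the choice of the pair they have degree at most `h`. -/
lemma exists_card_degree_le_of_not_isHamSeq {G : SimpleGraph V} [DecidableRel G.Adj]
    (h3 : 3 ≤ Fintype.card V) (hG : ¬ ∃ x, IsHamSeq G x) :
    ∃ h, G.minDegree ≤ h ∧ 2 * h < Fintype.card V ∧
      ∃ A : Finset V, #A = h ∧ ∀ a ∈ A, G.degree a ≤ h := by
  classical
  obtain ⟨M, hGM, hM⟩ :=
    (Set.toFinite {H : SimpleGraph V | ¬ ∃ x, IsHamSeq H x}).exists_le_maximal hG
  let P : Finset (V × V) := univ.filter fun p => p.1 ≠ p.2 ∧ ¬ M.Adj p.1 p.2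
  have hP : P.Nonempty := by
    by_contra hP
    have : M = ⊤ := by
      rw [SimpleGraph.eq_top_iff_forall_ne_adj]
      intro a b hab
      by_contra hn
      exact hP ⟨(a, b), by simp [P, hab, hn]⟩
    exact hM.prop (this ▸ exists_isHamSeq_top h3)
  obtain ⟨u, v, huv, hnadj, hle, hmax⟩ : ∃ u v, u ≠ v ∧ ¬ M.Adj u v ∧ M.degree u ≤ M.degree v ∧
      ∀ a b, a ≠ b → ¬ M.Adj a b → M.degree a + M.degree b ≤ M.degree u + M.degree v := by
    obtain ⟨⟨u, v⟩, hmem, hmax⟩ := P.exists_max_image (fun p => M.degree p.1 + M.degree p.2) hP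
    simp only [P, mem_filter, mem_univ, true_and] at hmem
    have hmax' : ∀ a b, a ≠ b → ¬ M.Adj a b →
        M.degree a + M.degree b ≤ M.degree u + M.degree v :=
      fun a b hab hn => hmax (a, b) (by simp [P, hab, hn])
    rcases le_total (M.degree u) (M.degree v) with h | h
    · exact ⟨u, v, hmem.1, hmem.2, h, hmax'⟩
    · exact ⟨v, u, hmem.1.symm, fun h' => hmem.2 h'.symm, h,
        fun a b hab hn => (hmax' a b hab hn).trans (add_comm _ _).le⟩
  have hsum : M.degree u + M.degree v < Fintype.card V := by
    by_contra! hdeg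
    have hham : ∃ x, IsHamSeq (M ⊔ SimpleGraph.edge u v) x := by
      by_contra hno
      exact hnadj (hM.le_of_ge hno le_sup_left
        (SimpleGraph.sup_adj .. |>.2 (Or.inr (by simp [SimpleGraph.edge_adj, huv]))))
    obtain ⟨x, hx⟩ := hham
    exact hM.prop (exists_isHamSeq_of_sup_edge h3 hx hdeg)
  have hcard : M.degree u ≤ #(univ \ insert v (M.neighborFinset v)) := by
    rw [card_sdiff_of_subset (subset_univ _), card_insert_of_notMem (by simp), card_univ,
      M.card_neighborFinset_eq_degree]
    omega
  obtain ⟨A, hA, hAc⟩ := exists_subset_card_eq hcard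
  refine ⟨M.degree u, (G.minDegree_le_degree u).trans (SimpleGraph.degree_le_of_le hGM), by omega,
    A, hAc, fun a ha => (SimpleGraph.degree_le_of_le hGM).trans ?_⟩
  have ha' := hA ha
  simp only [mem_sdiff, mem_univ, mem_insert, SimpleGraph.mem_neighborFinset, true_and,
    not_or] at ha'
  have := hmax a v ha'.1 fun h => ha'.2 h.symm
  omega

/-! ### Counting edges -/

/-- If `h` vertices have degree at most `h`, they meet at most `h ^ 2` edges, and the others span at
most `(n - h).choose 2`. -/
lemma two_mul_card_edgeFinset_le {G : SimpleGraph V} [DecidableRel G.Adj] {h : ℕ} {A : Finset V}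
    (hA : #A = h) (hdeg : ∀ a ∈ A, G.degree a ≤ h) :
    2 * #G.edgeFinset ≤
      2 * (h * h) + (Fintype.card V - h) * (Fintype.card V - h - 1) := by
  classical
  rw [← SimpleGraph.sum_degrees_eq_twice_card_edges, ← sum_add_sum_compl A]
  have hAc : #Aᶜ = Fintype.card V - h := by rw [card_compl, hA]
  have h1 : ∑ a ∈ A, G.degree a ≤ h * h := by
    simpa [hA] using sum_le_card_nsmul A _ h hdeg
  have hsplit : ∀ v, G.degree v =
      #(A.filter fun a => G.Adj v a) + #(Aᶜ.filter fun a => G.Adj v a) := by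
    intro v
    rw [← G.card_neighborFinset_eq_degree, G.neighborFinset_eq_filter,
      ← card_union_of_disjoint (disjoint_filter_filter disjoint_compl_right), ← filter_union,
      union_compl]
  have h2 : ∑ v ∈ Aᶜ, #(A.filter fun a => G.Adj v a) ≤ h * h := by
    refine le_trans ?_ h1
    rw [show ∑ v ∈ Aᶜ, #(A.filter fun a => G.Adj v a) =
        ∑ a ∈ A, #(Aᶜ.filter fun v => G.Adj v a) from
      sum_card_bipartiteAbove_eq_sum_card_bipartiteBelow _]
    refine sum_le_sum fun a _ => ?_
    rw [hsplit a]
    simp only [G.adj_comm a]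
    exact Nat.le_add_left _ _
  have h3 : ∑ v ∈ Aᶜ, #(Aᶜ.filter fun a => G.Adj v a) ≤
      (Fintype.card V - h) * (Fintype.card V - h - 1) := by
    rw [← hAc]
    refine (sum_le_card_nsmul _ _ (#Aᶜ - 1) fun v hv => ?_).trans (by simp)
    rw [← card_erase_of_mem hv]
    refine card_le_card fun a ha => ?_
    rw [mem_filter] at ha
    exact mem_erase.2 ⟨ha.2.ne', ha.1⟩
  have h4 : ∑ v ∈ Aᶜ, G.degree v = ∑ v ∈ Aᶜ, #(A.filter fun a => G.Adj v a) +
      ∑ v ∈ Aᶜ, #(Aᶜ.filter fun a => G.Adj v a) := by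
    rw [← sum_add_distrib]
    exact sum_congr rfl fun v _ => hsplit v
  omega

lemma size_eq_card_edgeFinset (G : SimpleGraph V) [DecidableRel G.Adj] :
    size G = #G.edgeFinset := by
  classical
  rw [size, ← SimpleGraph.coe_edgeFinset, Set.ncard_coe_finset]

/-- The degree sum of `K_d ∨ (K_k ∪ (d - 1) K_1)` with `k = n + 1 - 2 d`. -/
lemma two_mul_size_extremalGraph (n d : ℕ) :
    2 * size (extremalGraph n d) =
      d * ((d - 1) + ((n + 1 - 2 * d) + (d - 1))) +
        ((n + 1 - 2 * d) * (d + (n + 1 - 2 * d - 1)) + (d - 1) * d) := by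
  classical
  have hne : ∀ {k : ℕ} (i : Fin k), #(univ.filter fun j => i ≠ j) = k - 1 := by
    intro k i
    rw [filter_ne, card_erase_of_mem (mem_univ i), card_univ, Fintype.card_fin]
  rw [size_eq_card_edgeFinset, ← SimpleGraph.sum_degrees_eq_twice_card_edges]
  simp only [Fintype.sum_sum_type, ← SimpleGraph.card_neighborFinset_eq_degree,
    SimpleGraph.neighborFinset_eq_filter, card_filter]
  simp only [extremalGraph, join, SimpleGraph.sup_adj, SimpleGraph.sum_adj_inl,
    SimpleGraph.sum_adj_inr, SimpleGraph.top_adj, SimpleGraph.bot_adj]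
  have hne' : ∀ {k : ℕ} (i : Fin k), (∑ j, if i = j then 0 else 1) = k - 1 := by
    intro k i
    rw [← hne i, card_filter]
    exact sum_congr rfl fun j _ => by simp [ite_not]
  simp [hne', SimpleGraph.sum]

end EvenFactor

theorem theorem1p1 {V : Type*} [Fintype V] (G : SimpleGraph V) [DecidableRel G.Adj]
    (n δ : ℕ) (hconn : G.Connected) (hn : Fintype.card V = n) (heven : Even n)
    (hmin : G.minDegree = δ) (hδ : 2 ≤ δ)
    (hbound : max (6 * (δ : ℝ) - 4) (((δ : ℝ) ^ 2 + 7 * (δ : ℝ) + 4) / 6) ≤ (n : ℝ))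
    (hsize : EvenFactor.size (EvenFactor.extremalGraph n δ) ≤ EvenFactor.size G)
    (hne : ¬ Nonempty (G ≃g EvenFactor.extremalGraph n δ)) :
    EvenFactor.HasEvenFactor G := by
  have hb : 6 * δ ≤ n + 4 := by
    have h := (le_max_left _ _).trans hbound
    have : (6 * δ : ℝ) ≤ n + 4 := by linarith
    exact_mod_cast this
  have h3 : 3 ≤ Fintype.card V := by omega
  by_contra hno
  have hham : ¬ ∃ x, EvenFactor.IsHamSeq G x := fun ⟨x, hx⟩ => hno (hx.hasEvenFactor h3)
  obtain ⟨h, hδh, hhn, A, hA, hdeg⟩ :=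
    EvenFactor.exists_card_degree_le_of_not_isHamSeq h3 hham
  have hup := EvenFactor.two_mul_card_edgeFinset_le hA hdeg
  have hlow := (EvenFactor.two_mul_size_extremalGraph n δ).ge.trans (Nat.mul_le_mul_left 2 hsize)
  rw [← EvenFactor.size_eq_card_edgeFinset] at hup
  rw [hn] at hup hhn
  rw [hmin] at hδh
  replace hlow := hlow.trans hup
  -- natural-number differences are replaced by new variables
  obtain ⟨c, rfl⟩ := Nat.exists_eq_add_of_le hδh
  obtain ⟨d, rfl⟩ : ∃ d, δ = d + 1 := ⟨δ - 1, by omega⟩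
  obtain ⟨k, hk⟩ : ∃ k, n = 2 * d + 2 + k := ⟨n - (2 * d + 2), by omega⟩
  obtain ⟨p, hp⟩ : ∃ p, k + d = c + p := ⟨k + d - c, by omega⟩
  rw [show n - (d + 1 + c) = p + 1 by omega, show n + 1 - 2 * (d + 1) = k + 1 by omega] at hlow
  simp only [Nat.add_sub_cancel] at hlow
  -- parity of `n` improves `2 * (d + 1 + c) < n` by one
  have hck : 2 * c + 2 ≤ k := by
    obtain ⟨m, hm⟩ := heven
    omega
  -- the upper bound is maximal at `c = 0`, since `3 * c + 2 * d + 3 ≤ 2 * k`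
  have hc : c * (3 * c + 2 * d + 3) ≤ c * (2 * k) := Nat.mul_le_mul_left c (by omega)
  zify at hlow hc hp
  rw [show (p : ℤ) = k + d - c by linarith] at hlow
  have hk0 : (0 : ℤ) < k := by exact_mod_cast (by omega : 0 < k)
  nlinarith
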